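/- Let $M\ge 1$ and let $y_1,y_2,\dots$ be independent, identically distributed random vectors in $\mathbb{C}^M$, each zero-mean circularly symmetric complex Gaussian with diagonal covariance matrix $\mathrm{diag}(\sigma_1^2,\dots,\sigma_M^2)$, where $\sigma_m^2>0$ for all $m$; that is, each $y_k$ is jointly Gaussian with $\mathbb{E}[y_k]=0$, $\mathbb{E}[y_ky_k^H]=\mathrm{diag}(\sigma_1^2,\dots,\sigma_M^2)$ and $\mathbb{E}[y_ky_k^T]=0$. (This is the null hypothesis $\mathcal{H}_0$ that only noise is received; the values $\sigma_m^2$ are arbitrary and are not used in the statistic below.) For $K\ge 1$ let $$\hat R=\frac1K\sum_{k=1}^K y_ky_k^H=(\hat r_{mn}),\qquad \hat C=\frac1K\sum_{k=1}^K y_ky_k^T=(\hat c_{mn}),$$ and let the noncircular covariance (NCC) statistic be $$T_N=\sum_{1\le m<n\le M}\frac{|\hat r_{mn}|^2}{\hat r_{mm}\hat r_{nn}}+\sum_{m=1}^M\frac{|\hat c_{mm}|^2}{2\hat r_{mm}^2}+\sum_{1\le m<n\le M}\frac{|\hat c_{mn}|^2}{\hat r_{mm}\hat r_{nn}}.$$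 Let $\chi^2_{2M^2}$ denote the central chi-square distribution with $2M^2$ degrees of freedom and $Q_{\chi^2_{2M^2}}(x)=\Pr\{\chi^2_{2M^2}>x\}$ its tail probability. Then, as $K\to\infty$, $2K\,T_N$ converges in distribution to $\chi^2_{2M^2}$. Consequently the false-alarm probability $P_f=\Pr\{T_N>\lambda_N\}$ at decision threshold $\lambda_N$ is approximated by $Q_{\chi^2_{2M^2}}(2K\lambda_N)$, uniformly in the threshold: $$\lim_{K\to\infty}\ \sup_{\lambda_N\in\mathbb{R}}\bigl|\Pr\{T_N>\lambda_N\}-Q_{\chi^2_{2M^2}}(2K\lambda_N)\bigr|=0 .$$ -/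

import Mathlib

open MeasureTheory ProbabilityTheory Filter Topology
open scoped ComplexConjugate

namespace NCC

noncomputable section

/-- The standard covariance matrix `𝔼[z zᴴ]` of a (zero-mean) complex random vector. -/
def standardCov {Ω : Type*} [MeasurableSpace Ω] {M : ℕ} (z : Ω → Fin M → ℂ) (P : Measure Ω) :
    Matrix (Fin M) (Fin M) ℂ :=
  Matrix.of fun m n => ∫ ω, z ω m * conj (z ω n) ∂P

/-- The complementary covariance matrix `𝔼[z zᵀ]` of a (zero-mean) complex random vector. -/
def complementaryCov {Ω : Type*} [MeasurableSpace Ω] {M : ℕ} (z : Ω → Fin M → ℂ)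
    (P : Measure Ω) : Matrix (Fin M) (Fin M) ℂ :=
  Matrix.of fun m n => ∫ ω, z ω m * z ω n ∂P

/-- `z ∼ 𝒞𝒩(0, R)`: the random vector `z` is complex Gaussian (jointly Gaussian as a vector of the
real vector space `ℂ^M`), has mean zero and covariance matrix `R`, and is circular, that is, its
complementary covariance matrix vanishes. -/
structure IsCircularGaussian {Ω : Type*} [MeasurableSpace Ω] {M : ℕ} (z : Ω → Fin M → ℂ)
    (R : Matrix (Fin M) (Fin M) ℂ) (P : Measure Ω) : Prop where
  gaussian : HasGaussianLaw z P
  mean_zero : ∀ m, ∫ ω, z ω m ∂P = 0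
  cov_eq : standardCov z P = R
  circular : complementaryCov z P = 0

/-- The sample covariance matrix `R̂ = (1/K) ∑_k y_k y_kᴴ` of the first `K` vectors. -/
def sampleCov {M : ℕ} (y : ℕ → Fin M → ℂ) (K : ℕ) : Matrix (Fin M) (Fin M) ℂ :=
  Matrix.of fun m n => (1 / (K : ℂ)) * ∑ k ∈ Finset.range K, y k m * conj (y k n)

/-- The sample complementary covariance matrix `Ĉ = (1/K) ∑_k y_k y_kᵀ` of the first `K`
vectors. -/
def sampleComplementaryCov {M : ℕ} (y : ℕ → Fin M → ℂ) (K : ℕ) : Matrix (Fin M) (Fin M) ℂ :=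
  Matrix.of fun m n => (1 / (K : ℂ)) * ∑ k ∈ Finset.range K, y k m * y k n

/-- The noncircular covariance (NCC) statistic of the first `K` vectors. The diagonal entries of
the sample covariance matrix are real; `.re` only reads them as real numbers. -/
def nccStatistic {M : ℕ} (y : ℕ → Fin M → ℂ) (K : ℕ) : ℝ :=
  (∑ m : Fin M, ∑ n ∈ Finset.Ioi m,
      ‖sampleCov y K m n‖ ^ 2 / ((sampleCov y K m m).re * (sampleCov y K n n).re))
    + (∑ m : Fin M,
      ‖sampleComplementaryCov y K m m‖ ^ 2 / (2 * (sampleCov y K m m).re ^ 2))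
    + (∑ m : Fin M, ∑ n ∈ Finset.Ioi m,
      ‖sampleComplementaryCov y K m n‖ ^ 2 / ((sampleCov y K m m).re * (sampleCov y K n n).re))

/-- The central chi-square distribution with `d` degrees of freedom: the law of the sum of the
squares of `d` independent standard real Gaussian random variables. -/
def chiSquare (d : ℕ) : Measure ℝ :=
  (Measure.pi fun _ : Fin d => gaussianReal 0 1).map fun x => ∑ i, x i ^ 2

instance isProbabilityMeasure_chiSquare (d : ℕ) : IsProbabilityMeasure (chiSquare d) :=
  Measure.isProbabilityMeasure_map
    (Measurable.aemeasurable (Finset.measurable_fun_sum _ fun i _ =>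
      (measurable_pi_apply i).pow_const 2))

/-- The tail probability `Q(x)` of the central chi-square distribution with `d` degrees of
freedom. -/
def chiSquareTail (d : ℕ) (x : ℝ) : ℝ := (chiSquare d).real (Set.Ioi x)

end

end NCC

/-! Write `2 K T_N` as a weighted squared norm. The products `z m * conj (z n)` for `m < n` and `z m
* z n` for `n ≤ m` form one complex random vector indexed by `Fin M × Fin M`. Isserlis' theorem
shows that its entries are centred, pairwise uncorrelated and circular. Scaled to mean square `2`,
each entry has real and imaginary parts of variance `1`, so the covariance on the underlying real
space of dimension `2 M ^ 2` is the identity. By the central limit theorem the normalized sum tends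
to a standard Gaussian, whose squared norm is chi-square.

The statistic divides by estimated powers instead of true ones. This only introduces the weights
`powerRatio`, which tend to `1` by the strong law, and Slutsky's theorem absorbs them. The limit law
has no atoms, so Pólya's theorem makes the tails converge uniformly. -/

namespace NCC

/-! ### Fourth moments of Gaussian vectors -/

/-- A centred real Gaussian of variance `v` has fourth moment `3 v ^ 2`. -/
lemma integral_pow_four_gaussianReal (v : NNReal) :
    ∫ x, x ^ 4 ∂gaussianReal 0 v = 3 * (v : ℝ) ^ 2 := by
  have h := iteratedDeriv_mgf_zero (X := id) (μ := gaussianReal 0 v)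
    (by simp [integrableExpSet_id_gaussianReal]) 4
  -- Every derivative of the moment generating function is a polynomial times the same exponential;
  -- this is the recursion for the polynomial.
  have key (p p' : ℝ → ℝ) (hp : ∀ t, HasDerivAt p (p' t) t) :
      deriv (fun t => p t * Real.exp (v * t ^ 2 / 2))
        = fun t => (p' t + p t * (v * t)) * Real.exp (v * t ^ 2 / 2) := by
    funext t
    have h2 : HasDerivAt (fun t : ℝ => (v : ℝ) * t ^ 2 / 2) (v * t) t := by
      have := ((hasDerivAt_pow 2 t).const_mul (v : ℝ)).div_const 2
      convert! this using 1
      simp; ring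
    refine ((hp t).mul h2.exp).deriv.trans ?_
    ring
  have e0 : mgf id (gaussianReal 0 v) = fun t => 1 * Real.exp (v * t ^ 2 / 2) := by
    rw [mgf_id_gaussianReal]; simp
  have e1 := key (fun _ => 1) (fun _ => 0) (fun t => hasDerivAt_const _ _)
  have e2 := key (fun t => 0 + 1 * (v * t)) (fun _ => v) (fun t => by
    simpa using (hasDerivAt_id t).const_mul (v : ℝ))
  have e3 := key (fun t => v + (0 + 1 * (v * t)) * (v * t)) (fun t => 2 * v ^ 2 * t) (fun t => by
    convert! ((hasDerivAt_pow 2 t).const_mul ((v : ℝ) ^ 2)).const_add (v : ℝ) using 1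
    · funext t; ring
    · simp; ring)
  have e4 := key (fun t => 2 * v ^ 2 * t + (v + (0 + 1 * (v * t)) * (v * t)) * (v * t))
    (fun t => 3 * v ^ 2 + 3 * v ^ 3 * t ^ 2) (fun t => by
    convert! ((hasDerivAt_id t).const_mul (3 * (v : ℝ) ^ 2)).add
      ((hasDerivAt_pow 3 t).const_mul ((v : ℝ) ^ 3)) using 1
    · funext t; simp; ring
    · simp; ring)
  rw [iteratedDeriv_succ, iteratedDeriv_succ, iteratedDeriv_succ, iteratedDeriv_one, e0, e1, e2,
    e3, e4] at h
  simp at h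
  exact h.symm

variable {Ω : Type*} [MeasurableSpace Ω] {P : Measure Ω}

lemma integral_pow_four_of_hasGaussianLaw {X : Ω → ℝ} (hX : HasGaussianLaw X P)
    (h0 : ∫ ω, X ω ∂P = 0) : ∫ ω, X ω ^ 4 ∂P = 3 * (∫ ω, X ω ^ 2 ∂P) ^ 2 := by
  have hP := hX.isProbabilityMeasure
  have hv : Var[X; P] = ∫ ω, X ω ^ 2 ∂P := by
    rw [variance_of_integral_eq_zero hX.aemeasurable h0]
  have h := hX.map_eq_gaussianReal
  have h4 : ∫ ω, X ω ^ 4 ∂P = ∫ x, x ^ 4 ∂(P.map X) := by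
    rw [integral_map hX.aemeasurable (by fun_prop)]
  rw [h4, h, h0, integral_pow_four_gaussianReal, hv, Real.coe_toNNReal]
  exact integral_nonneg fun ω => sq_nonneg _

instance holderTriple_four_four_two : ENNReal.HolderTriple 4 4 2 where
  inv_add_inv_eq_inv := by
    rw [← two_mul, show (4 : ENNReal) = 2 * 2 by norm_num,
      ENNReal.mul_inv (by simp) (by simp), ← mul_assoc, ENNReal.mul_inv_cancel (by simp) (by simp),
      one_mul]

lemma integrable_mul_four {𝕜 : Type*} [RCLike 𝕜] {a b c d : Ω → 𝕜} (ha : MemLp a 4 P)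
    (hb : MemLp b 4 P) (hc : MemLp c 4 P) (hd : MemLp d 4 P) :
    Integrable (fun ω => a ω * b ω * (c ω * d ω)) P :=
  MemLp.integrable_mul (p := 2) (q := 2) 
    (hb.mul (p := 4) (q := 4) (r := 2) ha) (hd.mul (p := 4) (q := 4) (r := 2) hc)

/-- Fourth moment of a centred, not necessarily circular, complex Gaussian random variable. -/
lemma integral_pow_four_complex {Z : Ω → ℂ} (hZ : HasGaussianLaw Z P)
    (h0 : ∫ ω, Z ω ∂P = 0) : ∫ ω, Z ω ^ 4 ∂P = 3 * (∫ ω, Z ω ^ 2 ∂P) ^ 2 := by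
  have hP := hZ.isProbabilityMeasure
  have hint := hZ.integrable
  have hre : MemLp (fun ω => (Z ω).re) 4 P := (hZ.map_fun Complex.reCLM).memLp (by simp)
  have him : MemLp (fun ω => (Z ω).im) 4 P := (hZ.map_fun Complex.imCLM).memLp (by simp)
  have hre2 := hre.mono_exponent (p := 2) (by norm_num)
  have him2 := him.mono_exponent (p := 2) (by norm_num)
  have h0re : ∫ ω, (Z ω).re ∂P = 0 := by
    have := integral_re hint; simp only [RCLike.re_eq_complex_re] at this; rw [this, h0]; rfl
  have h0im : ∫ ω, (Z ω).im ∂P = 0 := by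
    have := integral_im hint; simp only [RCLike.im_eq_complex_im] at this; rw [this, h0]; rfl
  have i40 : Integrable (fun ω => (Z ω).re ^ 4) P := by
    convert integrable_mul_four hre hre hre hre using 2; ring
  have i31 : Integrable (fun ω => (Z ω).re ^ 3 * (Z ω).im) P := by
    convert integrable_mul_four hre hre hre him using 2; ring
  have i22 : Integrable (fun ω => (Z ω).re ^ 2 * (Z ω).im ^ 2) P := by
    convert integrable_mul_four hre hre him him using 2; ring
  have i13 : Integrable (fun ω => (Z ω).re * (Z ω).im ^ 3) P := by
    convert integrable_mul_four hre him him him using 2; ring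
  have i04 : Integrable (fun ω => (Z ω).im ^ 4) P := by
    convert integrable_mul_four him him him him using 2; ring
  have i20 : Integrable (fun ω => (Z ω).re ^ 2) P := hre2.integrable_sq
  have i02 : Integrable (fun ω => (Z ω).im ^ 2) P := him2.integrable_sq
  have i11 : Integrable (fun ω => (Z ω).re * (Z ω).im) P := hre2.integrable_mul him2
  -- `re + s * im` is a real Gaussian for every `s`. Both sides of its fourth-moment identity are
  -- quartic in `s`, so five values of `s` determine all mixed moments.
  have key (s : ℝ) := integral_pow_four_of_hasGaussianLaw
    (hZ.map_fun (Complex.reCLM + s • Complex.imCLM))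
    (by
      have hr : Integrable (fun ω => (Z ω).re) P := hre2.integrable (by norm_num)
      have hi : Integrable (fun ω => (Z ω).im) P := him2.integrable (by norm_num)
      simp [integral_add hr (hi.const_mul s), integral_const_mul, h0re, h0im])
  have e4 (s : ℝ) : ∫ ω, ((Complex.reCLM + s • Complex.imCLM : ℂ →L[ℝ] ℝ) (Z ω)) ^ 4 ∂P
      = ∫ ω, (Z ω).re ^ 4 ∂P + 4 * s * ∫ ω, (Z ω).re ^ 3 * (Z ω).im ∂P
        + 6 * s ^ 2 * ∫ ω, (Z ω).re ^ 2 * (Z ω).im ^ 2 ∂P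
        + 4 * s ^ 3 * ∫ ω, (Z ω).re * (Z ω).im ^ 3 ∂P + s ^ 4 * ∫ ω, (Z ω).im ^ 4 ∂P := by
    simp_rw [← integral_const_mul]
    rw [← integral_add (by fun_prop) (by fun_prop), ← integral_add (by fun_prop) (by fun_prop),
      ← integral_add (by fun_prop) (by fun_prop), ← integral_add (by fun_prop) (by fun_prop)]
    congr 1 with ω
    simp; ring
  have e2 (s : ℝ) : ∫ ω, ((Complex.reCLM + s • Complex.imCLM : ℂ →L[ℝ] ℝ) (Z ω)) ^ 2 ∂P
      = ∫ ω, (Z ω).re ^ 2 ∂P + 2 * s * ∫ ω, (Z ω).re * (Z ω).im ∂P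
        + s ^ 2 * ∫ ω, (Z ω).im ^ 2 ∂P := by
    simp_rw [← integral_const_mul]
    rw [← integral_add (by fun_prop) (by fun_prop), ← integral_add (by fun_prop) (by fun_prop)]
    congr 1 with ω
    simp; ring
  simp_rw [e4, e2] at key
  have c4 : ∫ ω, Z ω ^ 4 ∂P
      = ((∫ ω, (Z ω).re ^ 4 ∂P : ℝ) : ℂ)
        + 4 * Complex.I * ((∫ ω, (Z ω).re ^ 3 * (Z ω).im ∂P : ℝ) : ℂ)
        - 6 * ((∫ ω, (Z ω).re ^ 2 * (Z ω).im ^ 2 ∂P : ℝ) : ℂ)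
        - 4 * Complex.I * ((∫ ω, (Z ω).re * (Z ω).im ^ 3 ∂P : ℝ) : ℂ)
        + ((∫ ω, (Z ω).im ^ 4 ∂P : ℝ) : ℂ) := by
    have j40 := i40.ofReal (𝕜 := ℂ)
    have j31 := i31.ofReal (𝕜 := ℂ)
    have j22 := i22.ofReal (𝕜 := ℂ)
    have j13 := i13.ofReal (𝕜 := ℂ)
    have j04 := i04.ofReal (𝕜 := ℂ)
    simp only [Complex.coe_algebraMap] at j40 j31 j22 j13 j04
    simp_rw [← integral_complex_ofReal, ← integral_const_mul]
    rw [← integral_add (by fun_prop) (by fun_prop), ← integral_sub (by fun_prop) (by fun_prop),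
      ← integral_sub (by fun_prop) (by fun_prop), ← integral_add (by fun_prop) (by fun_prop)]
    congr 1 with ω
    conv_lhs => rw [← Complex.re_add_im (Z ω)]
    push_cast
    ring_nf
    simp only [Complex.I_sq, Complex.I_pow_three, Complex.I_pow_four]
    ring
  have c2 : ∫ ω, Z ω ^ 2 ∂P
      = ((∫ ω, (Z ω).re ^ 2 ∂P : ℝ) : ℂ)
        + 2 * Complex.I * ((∫ ω, (Z ω).re * (Z ω).im ∂P : ℝ) : ℂ)
        - ((∫ ω, (Z ω).im ^ 2 ∂P : ℝ) : ℂ) := by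
    have j20 := i20.ofReal (𝕜 := ℂ)
    have j11 := i11.ofReal (𝕜 := ℂ)
    have j02 := i02.ofReal (𝕜 := ℂ)
    simp only [Complex.coe_algebraMap] at j20 j11 j02
    simp_rw [← integral_complex_ofReal, ← integral_const_mul]
    rw [← integral_add (by fun_prop) (by fun_prop), ← integral_sub (by fun_prop) (by fun_prop)]
    congr 1 with ω
    conv_lhs => rw [← Complex.re_add_im (Z ω)]
    push_cast
    ring_nf
    simp only [Complex.I_sq]
    ring
  rw [c4, c2]
  have k0 := key 0
  have k1 := key 1
  have k2 := key (-1)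
  have k3 := key 2
  have k4 := key (-2)
  generalize ∫ ω, (Z ω).re ^ 4 ∂P = m40 at *
  generalize ∫ ω, (Z ω).re ^ 3 * (Z ω).im ∂P = m31 at *
  generalize ∫ ω, (Z ω).re ^ 2 * (Z ω).im ^ 2 ∂P = m22 at *
  generalize ∫ ω, (Z ω).re * (Z ω).im ^ 3 ∂P = m13 at *
  generalize ∫ ω, (Z ω).im ^ 4 ∂P = m04 at *
  generalize ∫ ω, (Z ω).re ^ 2 ∂P = c20 at *
  generalize ∫ ω, (Z ω).re * (Z ω).im ∂P = c11 at *
  generalize ∫ ω, (Z ω).im ^ 2 ∂P = c02 at *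
  have r40 : m40 = 3 * c20 ^ 2 := by linarith
  have r31 : m31 = 3 * c20 * c11 := by linarith
  have r22 : m22 = c20 * c02 + 2 * c11 ^ 2 := by linarith
  have r13 : m13 = 3 * c02 * c11 := by linarith
  have r04 : m04 = 3 * c02 ^ 2 := by linarith
  rw [r40, r31, r22, r13, r04]
  push_cast
  ring_nf
  simp only [Complex.I_sq]
  ring

/-- **Isserlis' theorem** for four complex-valued real-linear functionals of a centred Gaussian
random vector. -/
lemma integral_mul_four_of_hasGaussianLaw {E : Type*} [NormedAddCommGroup E] [NormedSpace ℝ E]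
    [CompleteSpace E] [SecondCountableTopology E] [MeasurableSpace E] [BorelSpace E]
    {X : Ω → E} (hX : HasGaussianLaw X P) (h0 : ∫ ω, X ω ∂P = 0) (a b c d : E →L[ℝ] ℂ) :
    ∫ ω, a (X ω) * b (X ω) * (c (X ω) * d (X ω)) ∂P
      = (∫ ω, a (X ω) * b (X ω) ∂P) * (∫ ω, c (X ω) * d (X ω) ∂P)
        + (∫ ω, a (X ω) * c (X ω) ∂P) * (∫ ω, b (X ω) * d (X ω) ∂P)
        + (∫ ω, a (X ω) * d (X ω) ∂P) * (∫ ω, b (X ω) * c (X ω) ∂P) := by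
  have m4 (l : E →L[ℝ] ℂ) : MemLp (fun ω => l (X ω)) 4 P := (hX.map_fun l).memLp (by simp)
  have hP := hX.isProbabilityMeasure
  have i4 (l : E →L[ℝ] ℂ) : Integrable (fun ω => l (X ω) ^ 4) P := by
    convert integrable_mul_four (m4 l) (m4 l) (m4 l) (m4 l) using 2; ring
  have i2 (l l' : E →L[ℝ] ℂ) : Integrable (fun ω => l (X ω) * l' (X ω)) P :=
    ((m4 l).mono_exponent (p := 2) (by norm_num)).integrable_mul
      ((m4 l').mono_exponent (p := 2) (by norm_num))
  have k (l : E →L[ℝ] ℂ) : ∫ ω, l (X ω) ^ 4 ∂P = 3 * (∫ ω, l (X ω) * l (X ω) ∂P) ^ 2 := by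
    simp_rw [← sq]
    exact integral_pow_four_complex (hX.map_fun l)
      (by rw [l.integral_comp_comm hX.integrable, h0, map_zero])
  have q (r s t : ℝ) : ∫ ω, (a + r • b + s • c + t • d) (X ω) * (a + r • b + s • c + t • d) (X ω) ∂P
      = ∫ ω, a (X ω) * a (X ω) ∂P + r ^ 2 * ∫ ω, b (X ω) * b (X ω) ∂P
        + s ^ 2 * ∫ ω, c (X ω) * c (X ω) ∂P + t ^ 2 * ∫ ω, d (X ω) * d (X ω) ∂P
        + 2 * r * ∫ ω, a (X ω) * b (X ω) ∂P + 2 * s * ∫ ω, a (X ω) * c (X ω) ∂P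
        + 2 * t * ∫ ω, a (X ω) * d (X ω) ∂P + 2 * r * s * ∫ ω, b (X ω) * c (X ω) ∂P
        + 2 * r * t * ∫ ω, b (X ω) * d (X ω) ∂P + 2 * s * t * ∫ ω, c (X ω) * d (X ω) ∂P := by
    have := i2
    simp_rw [← integral_const_mul]
    repeat rw [← integral_add (by fun_prop) (by fun_prop)]
    congr 1 with ω
    simp; ring
  -- Polarization: in the sum over signs of `r s t (a + r b + s c + t d) ^ 4` only `a b c d`
  -- survives, with coefficient `8 * 24 = 192`.
  have p : 192 * ∫ ω, a (X ω) * b (X ω) * (c (X ω) * d (X ω)) ∂P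
      = ∫ ω, ((a + (1 : ℝ) • b + (1 : ℝ) • c + (1 : ℝ) • d) (X ω)) ^ 4 ∂P
        - ∫ ω, ((a + (1 : ℝ) • b + (1 : ℝ) • c + (-1 : ℝ) • d) (X ω)) ^ 4 ∂P
        - ∫ ω, ((a + (1 : ℝ) • b + (-1 : ℝ) • c + (1 : ℝ) • d) (X ω)) ^ 4 ∂P
        + ∫ ω, ((a + (1 : ℝ) • b + (-1 : ℝ) • c + (-1 : ℝ) • d) (X ω)) ^ 4 ∂P
        - ∫ ω, ((a + (-1 : ℝ) • b + (1 : ℝ) • c + (1 : ℝ) • d) (X ω)) ^ 4 ∂P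
        + ∫ ω, ((a + (-1 : ℝ) • b + (1 : ℝ) • c + (-1 : ℝ) • d) (X ω)) ^ 4 ∂P
        + ∫ ω, ((a + (-1 : ℝ) • b + (-1 : ℝ) • c + (1 : ℝ) • d) (X ω)) ^ 4 ∂P
        - ∫ ω, ((a + (-1 : ℝ) • b + (-1 : ℝ) • c + (-1 : ℝ) • d) (X ω)) ^ 4 ∂P := by
    have i (r s t : ℝ) := i4 (a + r • b + s • c + t • d)
    rw [← integral_const_mul, ← integral_sub (i _ _ _) (i _ _ _),
      ← integral_sub (by fun_prop) (i _ _ _), ← integral_add (by fun_prop) (i _ _ _), ← integral_sub (by fun_prop) (i _ _ _),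
      ← integral_add (by fun_prop) (i _ _ _), ← integral_add (by fun_prop) (i _ _ _),
      ← integral_sub (by fun_prop) (i _ _ _)]
    congr 1 with ω
    simp; ring
  simp_rw [k, q] at p
  push_cast at p
  linear_combination p / 192

/-- The real part of a complex linear combination of circular uncorrelated variables. -/
lemma integral_re_sum_sq {ι : Type*} [Fintype ι] [DecidableEq ι] {Z : ι → Ω → ℂ}
    (hZ : ∀ i, MemLp (Z i) 2 P) (h0 : ∀ i j, ∫ ω, Z i ω * Z j ω ∂P = 0) (c : ι → ℝ)
    (h1 : ∀ i j, ∫ ω, Z i ω * conj (Z j ω) ∂P = if i = j then (c i : ℂ) else 0) (a : ι → ℂ) :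
    ∫ ω, (∑ i, a i * Z i ω).re ^ 2 ∂P = (∑ i, ‖a i‖ ^ 2 * c i) / 2 := by
  have hZc (i) : MemLp (fun ω => conj (Z i ω)) 2 P := (hZ i).star
  have j0 (i j) : Integrable (fun ω => Z i ω * Z j ω) P := (hZ i).integrable_mul (hZ j)
  have j1 (i j) : Integrable (fun ω => Z i ω * conj (Z j ω)) P := (hZ i).integrable_mul (hZc j)
  -- `(re S) ^ 2 = (S ^ 2 + conj S ^ 2 + 2 |S| ^ 2) / 4`; circularity kills the mean of the first
  -- two terms.
  have e (ω : Ω) : (((∑ i, a i * Z i ω).re ^ 2 : ℝ) : ℂ)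
      = (∑ i, ∑ j, (a i * a j) * (Z i ω * Z j ω)
        + ∑ i, ∑ j, (conj (a i) * conj (a j)) * conj (Z i ω * Z j ω)
        + 2 * ∑ i, ∑ j, (a i * conj (a j)) * (Z i ω * conj (Z j ω))) / 4 := by
    have s1 : ∑ i, ∑ j, (a i * a j) * (Z i ω * Z j ω) = (∑ i, a i * Z i ω) * ∑ i, a i * Z i ω := by
      rw [Finset.sum_mul_sum]; congr! 2; ring
    have s2 : ∑ i, ∑ j, (conj (a i) * conj (a j)) * conj (Z i ω * Z j ω)
        = conj (∑ i, a i * Z i ω) * conj (∑ i, a i * Z i ω) := by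
      rw [map_sum, Finset.sum_mul_sum]; congr! 2; simp; ring
    have s3 : ∑ i, ∑ j, (a i * conj (a j)) * (Z i ω * conj (Z j ω))
        = (∑ i, a i * Z i ω) * conj (∑ i, a i * Z i ω) := by
      rw [map_sum, Finset.sum_mul_sum]; congr! 2; simp; ring
    rw [s1, s2, s3, Complex.ofReal_pow, Complex.re_eq_add_conj]
    ring
  have j2 (i j) : Integrable (fun ω => conj (Z i ω * Z j ω)) P := by
    simp only [map_mul]; exact (hZc i).integrable_mul (hZc j)
  have int_sum {g : ι → ι → Ω → ℂ} (hg : ∀ i j, Integrable (g i j) P) (b : ι → ι → ℂ) :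
      Integrable (fun ω => ∑ i, ∑ j, b i j * g i j ω) P :=
    integrable_finsetSum _ fun i _ => integrable_finsetSum _ fun j _ => (hg i j).const_mul _
  have integral_sum {g : ι → ι → Ω → ℂ} (hg : ∀ i j, Integrable (g i j) P) (b : ι → ι → ℂ) :
      ∫ ω, ∑ i, ∑ j, b i j * g i j ω ∂P = ∑ i, ∑ j, b i j * ∫ ω, g i j ω ∂P := by
    rw [integral_finsetSum _ fun i _ =>
      integrable_finsetSum _ fun j _ => (hg i j).const_mul (b i j)]
    refine Finset.sum_congr rfl fun i _ => ?_
    rw [integral_finsetSum _ fun j _ => (hg i j).const_mul (b i j)]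
    simp_rw [integral_const_mul]
  have k0 := int_sum j0 fun i j => a i * a j
  have k1 := int_sum j1 fun i j => a i * conj (a j)
  have k2 := int_sum j2 fun i j => conj (a i) * conj (a j)
  rw [← Complex.ofReal_inj, ← integral_complex_ofReal]
  simp_rw [e]
  rw [integral_div, integral_add (by fun_prop) (by fun_prop), integral_add k0 k2,
    integral_const_mul, integral_sum j0, integral_sum j1, integral_sum j2]
  simp_rw [integral_conj, h0, h1]
  simp [Complex.mul_conj, Complex.normSq_eq_norm_sq]
  ring

/-! ### Central limit theorem, chi-square law and uniform convergence of tails -/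

/-- Multivariate central limit theorem with identity limiting covariance. -/
theorem tendstoInDistribution_stdGaussian {E : Type*} [NormedAddCommGroup E]
    [InnerProductSpace ℝ E] [FiniteDimensional ℝ E] [MeasurableSpace E] [BorelSpace E]
    [IsProbabilityMeasure P] {X : ℕ → Ω → E} (hX : MemLp (X 0) 2 P)
    (h0 : ∀ t, ∫ ω, inner ℝ (X 0 ω) t ∂P = 0) (h1 : ∀ t, ∫ ω, inner ℝ (X 0 ω) t ^ 2 ∂P = ‖t‖ ^ 2)
    (hindep : iIndepFun X P) (hident : ∀ k, IdentDistrib (X k) (X 0) P P) :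
    TendstoInDistribution (fun (n : ℕ) ω => (√n)⁻¹ • ∑ k ∈ Finset.range n, X k ω) atTop
      (id : E → E) (fun _ => P) (stdGaussian E) where
  forall_aemeasurable n :=
    .const_smul (Finset.aemeasurable_fun_sum _ fun _ _ => (hident _).aemeasurable_fst) _
  tendsto := by
    refine ProbabilityMeasure.tendsto_iff_tendsto_charFun.2 fun t => ?_
    have mX (n : ℕ) := (hident n).aemeasurable_fst
    have hv : Var[fun ω => inner ℝ (X 0 ω) t; P] = ‖t‖ ^ 2 := by
      rw [variance_of_integral_eq_zero (by fun_prop) (h0 t)]; exact h1 t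
    -- Cramér–Wold: the characteristic function of the vector at `t` is that of its projection on
    -- `t` at `1`.
    have hclt := tendstoInDistribution_inv_sqrt_mul_sum_sub (P := P)
      (X := fun k ω => inner ℝ (X k ω) t) (Y := id)
      (P' := gaussianReal 0 Var[fun ω => inner ℝ (X 0 ω) t; P].toNNReal) ⟨by fun_prop, by simp⟩
      (hX.inner_const t) (hindep.comp (fun _ x => inner ℝ x t) (by fun_prop))
      (fun k => (hident k).comp (u := fun x => inner ℝ x t) (by fun_prop))
    have h := ProbabilityMeasure.tendsto_iff_tendsto_charFun.1 hclt.tendsto 1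
    simp only [ProbabilityMeasure.coe_mk, Measure.map_id, hv, charFun_gaussianReal, h0] at h ⊢
    rw [charFun_stdGaussian]
    convert! h using 2 with n
    · have m1 : AEMeasurable (fun ω => (√n)⁻¹ • ∑ k ∈ Finset.range n, X k ω) P :=
        .const_smul (Finset.aemeasurable_fun_sum _ fun _ _ => mX _) _
      have m2 : AEMeasurable (fun ω => (√n)⁻¹ * (∑ k ∈ Finset.range n, inner ℝ (X k ω) t - n * 0)) P :=
        .const_mul (.sub_const (Finset.aemeasurable_fun_sum _ fun _ _ => (mX _).inner_const) _) _
      rw [charFun_apply, charFun_apply, integral_map m1 (by fun_prop), integral_map m2 (by fun_prop)]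
      simp [inner_smul_left, sum_inner]
    · simp
      ring_nf

/-- The squared norm of a standard Gaussian vector is chi-square distributed. -/
lemma map_norm_sq_stdGaussian (E : Type*) [NormedAddCommGroup E] [InnerProductSpace ℝ E]
    [FiniteDimensional ℝ E] [MeasurableSpace E] [BorelSpace E] :
    (stdGaussian E).map (fun x => ‖x‖ ^ 2) = chiSquare (Module.finrank ℝ E) := by
  rw [stdGaussian, chiSquare, Measure.map_map (by fun_prop) (by fun_prop)]
  congr 1
  funext x
  have h := (stdOrthonormalBasis ℝ E).orthonormal.inner_sum x x Finset.univ
  simp only [Function.comp_apply]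
  rw [← real_inner_self_eq_norm_sq, h]
  simp [sq]

/-- The chi-square distribution has no atoms. -/
lemma chiSquare_singleton (d : ℕ) (hd : d ≠ 0) (c : ℝ) : chiSquare d {c} = 0 := by
  obtain ⟨n, rfl⟩ := Nat.exists_eq_succ_of_ne_zero hd
  have hm : Measurable fun x : Fin (n + 1) → ℝ => ∑ i, x i ^ 2 := by fun_prop
  rw [chiSquare, Measure.map_apply hm (measurableSet_singleton c)]
  -- Fubini: with the other coordinates fixed, the first one is confined to at most two values, a
  -- null set for its Gaussian law.
  have hmp := measurePreserving_piFinSuccAbove (fun _ : Fin (n + 1) => gaussianReal 0 1) 0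
  have hset : (fun x : Fin (n + 1) → ℝ => ∑ i, x i ^ 2) ⁻¹' {c}
      = (MeasurableEquiv.piFinSuccAbove (fun _ : Fin (n + 1) => ℝ) 0) ⁻¹'
        {p | p.1 ^ 2 + ∑ i, p.2 i ^ 2 = c} := by
    ext x
    simp [Fin.sum_univ_succ, MeasurableEquiv.piFinSuccAbove, Fin.tail]
  have hms : MeasurableSet {p : ℝ × (Fin n → ℝ) | p.1 ^ 2 + ∑ i, p.2 i ^ 2 = c} :=
    (measurableSet_singleton c).preimage
      (f := fun p : ℝ × (Fin n → ℝ) => p.1 ^ 2 + ∑ i, p.2 i ^ 2) (by fun_prop)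
  rw [hset, hmp.measure_preimage hms.nullMeasurableSet, Measure.prod_apply_symm hms,
    lintegral_eq_zero_of_ae_eq_zero]
  refine Eventually.of_forall fun z => ?_
  have := nullSingletonClass_gaussianReal (μ := 0) (v := 1) one_ne_zero
  refine Set.Finite.measure_zero (Set.Finite.subset
    (Set.toFinite {√(c - ∑ i, z i ^ 2), -√(c - ∑ i, z i ^ 2)}) fun x hx => ?_) _
  have hx : x ^ 2 + ∑ i, z i ^ 2 = c := hx
  have : c - ∑ i, z i ^ 2 = x ^ 2 := by linarith
  rw [this, Real.sqrt_sq_eq_abs]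
  rcases abs_choice x with h | h <;> simp [h]

/-- **Pólya's theorem**: weak convergence to an atomless law on `ℝ` makes the tail probabilities
converge uniformly. -/
lemma eventually_forall_abs_tail_sub_lt {μs : ℕ → ProbabilityMeasure ℝ} {μ : ProbabilityMeasure ℝ}
    (h : Tendsto μs atTop (𝓝 μ)) (hμ : ∀ x, (μ : Measure ℝ) {x} = 0) {ε : ℝ} (hε : 0 < ε) :
    ∀ᶠ K in atTop, ∀ x : ℝ,
      |(μs K : Measure ℝ).real (Set.Ioi x) - (μ : Measure ℝ).real (Set.Ioi x)| < ε := by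
  set F : ℝ → ℝ := fun x => (μ : Measure ℝ).real (Set.Ioi x) with hF
  set G : ℕ → ℝ → ℝ := fun K x => (μs K : Measure ℝ).real (Set.Ioi x) with hG
  have hpt (x : ℝ) : Tendsto (fun K => G K x) atTop (𝓝 (F x)) := by
    have := ProbabilityMeasure.tendsto_measure_of_null_frontier_of_tendsto' h
      (E := Set.Ioi x) (by simp [hμ])
    exact (ENNReal.tendsto_toReal (measure_ne_top _ _)).comp this
  have aF {a b : ℝ} (hab : a ≤ b) : F b ≤ F a := measureReal_mono (Set.Ioi_subset_Ioi hab)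
  have aG (K : ℕ) {a b : ℝ} (hab : a ≤ b) : G K b ≤ G K a :=
    measureReal_mono (Set.Ioi_subset_Ioi hab)
  have hna : NullSingletonClass (μ : Measure ℝ) := ⟨hμ⟩
  have hFc : F = fun x => 1 - cdf (μ : Measure ℝ) x := by
    funext x
    rw [cdf_eq_real, ← probReal_compl_eq_one_sub measurableSet_Iic, Set.compl_Iic]
  have hcont : Continuous F := by
    rw [hFc]
    refine continuous_const.sub (continuous_iff_continuousAt.2 fun x => ?_)
    -- The mass of an atom is the jump of the cdf.
    have hs := (cdf (μ : Measure ℝ)).measure_singleton x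
    rw [measure_cdf, hμ] at hs
    have hle := ENNReal.ofReal_eq_zero.1 hs.symm
    have hle' := (cdf (μ : Measure ℝ)).mono.leftLim_le (le_refl x)
    rw [(cdf (μ : Measure ℝ)).mono.continuousAt_iff_leftLim_eq_rightLim,
      StieltjesFunction.rightLim_eq]
    linarith
  have htop : Tendsto F atTop (𝓝 0) := by
    rw [hFc]; simpa using (tendsto_cdf_atTop (μ : Measure ℝ)).const_sub 1
  have hbot : Tendsto F atBot (𝓝 1) := by
    rw [hFc]; simpa using (tendsto_cdf_atBot (μ : Measure ℝ)).const_sub 1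
  obtain ⟨b, hb⟩ := (htop.eventually_lt_const (show 0 < ε / 2 by positivity)).exists
  obtain ⟨a, ha⟩ := (hbot.eventually_const_lt (show 1 - ε / 2 < 1 by linarith)).exists
  have key : ∀ᶠ K in atTop, ∀ x ∈ Set.Icc a b, |G K x - F x| < ε := by
    refine isCompact_Icc.induction_on (p := fun s => ∀ᶠ K in atTop, ∀ x ∈ s, |G K x - F x| < ε)
      (by simp) (fun s t hst ht => ht.mono fun K hK x hx => hK x (hst hx))
      (fun s t hs ht => (hs.and ht).mono fun K hK x hx => hx.elim (hK.1 x) (hK.2 x))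
      fun x _ => ?_
    -- Both tails are monotone, so near `x` they are squeezed between their values at `x ± δ / 2`.
    -- Three errors of `ε / 4` add up.
    obtain ⟨δ, hδ, hx⟩ := Metric.continuousAt_iff.1 hcont.continuousAt (ε / 4) (by positivity)
    have h1 := hx (show dist (x - δ / 2) x < δ by simp [abs_of_pos hδ, hδ])
    have h2 := hx (show dist (x + δ / 2) x < δ by simp [abs_of_pos hδ, hδ])
    rw [Real.dist_eq, abs_lt] at h1 h2
    refine ⟨Set.Ioo (x - δ / 2) (x + δ / 2),
      mem_nhdsWithin_of_mem_nhds (Ioo_mem_nhds (by linarith) (by linarith)), ?_⟩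
    filter_upwards [(Metric.tendsto_nhds.1 (hpt (x - δ / 2))) (ε / 4) (by positivity),
      (Metric.tendsto_nhds.1 (hpt (x + δ / 2))) (ε / 4) (by positivity)] with K hK1 hK2 y hy
    rw [Real.dist_eq, abs_lt] at hK1 hK2
    have := aG K hy.1.le
    have := aG K hy.2.le
    have := aF hy.1.le
    have := aF hy.2.le
    rw [abs_lt]
    constructor <;> linarith
  filter_upwards [key, (Metric.tendsto_nhds.1 (hpt a)) (ε / 2) (by positivity),
    (Metric.tendsto_nhds.1 (hpt b)) (ε / 2) (by positivity)] with K hK hKa hKb x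
  rw [Real.dist_eq, abs_lt] at hKa hKb
  have g0 : 0 ≤ G K x := measureReal_nonneg
  have g1 : G K x ≤ 1 := measureReal_le_one
  have f0 : 0 ≤ F x := measureReal_nonneg
  have f1 : F x ≤ 1 := measureReal_le_one
  change |G K x - F x| < ε
  rcases lt_or_ge x a with hxa | hxa
  · have := aG K hxa.le
    have := aF hxa.le
    rw [abs_lt]; constructor <;> linarith
  rcases lt_or_ge b x with hxb | hxb
  · have := aG K hxb.le
    have := aF hxb.le
    rw [abs_lt]; constructor <;> linarith
  exact hK x ⟨hxa, hxb⟩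

/-! ### Circular Gaussian vectors with diagonal covariance -/

variable {M : ℕ} {v : Fin M → ℝ}

namespace IsCircularGaussian

variable {z : Ω → Fin M → ℂ}

lemma integral_mul_eq_zero {R : Matrix (Fin M) (Fin M) ℂ} (h : IsCircularGaussian z R P)
    (m n : Fin M) : ∫ ω, z ω m * z ω n ∂P = 0 := by
  simpa [complementaryCov] using congrFun₂ h.circular m n

lemma integral_mul_conj (h : IsCircularGaussian z (Matrix.diagonal fun m => (v m : ℂ)) P)
    (m n : Fin M) : ∫ ω, z ω m * conj (z ω n) ∂P = if m = n then (v m : ℂ) else 0 := by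
  simpa [standardCov, Matrix.diagonal_apply] using congrFun₂ h.cov_eq m n

lemma memLp_eval {R : Matrix (Fin M) (Fin M) ℂ} (h : IsCircularGaussian z R P) (m : Fin M)
    {p : ENNReal} (hp : p ≠ ⊤) : MemLp (fun ω => z ω m) p P :=
  (h.gaussian.map_fun (ContinuousLinearMap.proj (R := ℝ) (φ := fun _ : Fin M => ℂ) m)).memLp hp

lemma integral_eq_zero {R : Matrix (Fin M) (Fin M) ℂ} (h : IsCircularGaussian z R P) :
    ∫ ω, z ω ∂P = 0 := by
  funext m
  have := (ContinuousLinearMap.proj (R := ℝ) (φ := fun _ : Fin M => ℂ) m).integral_comp_comm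
    h.gaussian.integrable
  simp only [ContinuousLinearMap.proj_apply] at this
  rw [← this, h.mean_zero]
  rfl

end IsCircularGaussian

/-- A real functional on `ℂ^M` is the real part of a complex-linear one, which brings its variance
within reach of `integral_re_sum_sq`. -/
lemma dual_apply_eq_re_sum (L : StrongDual ℝ (Fin M → ℂ)) (z : Fin M → ℂ) :
    L z = (∑ m, ((L (Pi.single m 1) : ℂ) - L (Pi.single m Complex.I) * Complex.I) * z m).re := by
  conv_lhs => rw [← Finset.univ_sum_single z, map_sum]
  rw [Complex.re_sum]
  refine Finset.sum_congr rfl fun m _ => ?_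
  have e : Pi.single m (z m) = (z m).re • (Pi.single m 1 : Fin M → ℂ)
      + (z m).im • (Pi.single m Complex.I : Fin M → ℂ) := by
    rw [← Pi.single_smul, ← Pi.single_smul, ← Pi.single_add]
    congr 1
    simp [Complex.re_add_im]
  rw [e, map_add, map_smul, map_smul]
  simp
  ring

/-- A centred circular Gaussian law with diagonal covariance is determined by that covariance. -/
lemma IsCircularGaussian.map_eq {z w : Ω → Fin M → ℂ}
    (hz : IsCircularGaussian z (Matrix.diagonal fun m => (v m : ℂ)) P)
    (hw : IsCircularGaussian w (Matrix.diagonal fun m => (v m : ℂ)) P) : P.map z = P.map w := by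
  have hP := hz.gaussian.isProbabilityMeasure
  have key {z : Ω → Fin M → ℂ} (hz : IsCircularGaussian z (Matrix.diagonal fun m => (v m : ℂ)) P)
      (L : StrongDual ℝ (Fin M → ℂ)) : charFunDual (P.map z) L = Complex.exp (-
        (((∑ m, ‖(L (Pi.single m 1) : ℂ) - L (Pi.single m Complex.I) * Complex.I‖ ^ 2 * v m) / 2 : ℝ)
          : ℂ) / 2) := by
    have h0 : ∫ ω, L (z ω) ∂P = 0 := by
      rw [L.integral_comp_comm hz.gaussian.integrable, hz.integral_eq_zero, map_zero]
    have hm := hz.gaussian.aemeasurable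
    rw [hz.gaussian.charFunDual_map_eq_fun, h0,
      variance_of_integral_eq_zero (by fun_prop) h0,
      ← integral_re_sum_sq (Z := fun m ω => z ω m) (fun m => hz.memLp_eval m (by simp))
        hz.integral_mul_eq_zero v hz.integral_mul_conj]
    simp_rw [← dual_apply_eq_re_sum]
    simp [neg_div]
  have hz' := hz.gaussian.isGaussian_map
  have hw' := hw.gaussian.isGaussian_map
  refine Measure.ext_of_charFunDual ?_
  funext L
  rw [key hz, key hw]

/-! ### The vector of cross terms and its covariance -/

/-- The coordinate functional `z ↦ z m`, conjugated when `s` holds. -/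
noncomputable def coordCLM (s : Bool) (m : Fin M) : (Fin M → ℂ) →L[ℝ] ℂ :=
  if s then Complex.conjCLE.toContinuousLinearMap ∘L ContinuousLinearMap.proj m
  else ContinuousLinearMap.proj m

lemma coordCLM_apply (s : Bool) (m : Fin M) (z : Fin M → ℂ) :
    coordCLM s m z = if s then conj (z m) else z m := by
  cases s <;> simp [coordCLM]

lemma conj_coordCLM (s : Bool) (m : Fin M) (z : Fin M → ℂ) :
    conj (coordCLM s m z) = coordCLM (!s) m z := by
  cases s <;> simp [coordCLM_apply]

lemma IsCircularGaussian.integral_coordCLM_mul {z : Ω → Fin M → ℂ}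
    (h : IsCircularGaussian z (Matrix.diagonal fun m => (v m : ℂ)) P) (s t : Bool) (m n : Fin M) :
    ∫ ω, coordCLM s m (z ω) * coordCLM t n (z ω) ∂P
      = if s ≠ t ∧ m = n then (v m : ℂ) else 0 := by
  have h1 := h.integral_mul_eq_zero m n
  have h2 := h.integral_mul_conj m n
  have h3 := h.integral_mul_conj n m
  cases s <;> cases t <;> simp only [coordCLM_apply]
  · simpa using h1
  · simpa using h2
  · simp only [if_true, Bool.false_eq_true, if_false, mul_comm (conj (z _ m)), h3]
    grind
  · simp_rw [if_true, ← map_mul, integral_conj, h1]; simp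

/-- The summand of the sample (complementary) covariance indexed by `i`: the pairs `m < n`
index the products `z m * conj (z n)`, the other ones the products `z m * z n`. -/
noncomputable def crossTerm (i : Fin M × Fin M) (z : Fin M → ℂ) : ℂ :=
  coordCLM false i.1 z * coordCLM (i.1 < i.2) i.2 z

/-- The mean square of `crossTerm i`. -/
noncomputable def crossPower (v : Fin M → ℝ) (i : Fin M × Fin M) : ℝ :=
  if i.1 = i.2 then 2 * (v i.1 * v i.2) else v i.1 * v i.2

@[fun_prop]
lemma measurable_crossTerm (i : Fin M × Fin M) : Measurable (crossTerm i) :=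
  (coordCLM false i.1).measurable.mul (coordCLM (i.1 < i.2) i.2).measurable

namespace IsCircularGaussian

variable {z : Ω → Fin M → ℂ}

lemma memLp_crossTerm {R : Matrix (Fin M) (Fin M) ℂ} (h : IsCircularGaussian z R P)
    (i : Fin M × Fin M) : MemLp (fun ω => crossTerm i (z ω)) 2 P :=
  ((h.gaussian.map_fun (coordCLM (i.1 < i.2) i.2)).memLp (p := 4) (by simp)).mul
    ((h.gaussian.map_fun (coordCLM false i.1)).memLp (p := 4) (by simp))

lemma integral_crossTerm (h : IsCircularGaussian z (Matrix.diagonal fun m => (v m : ℂ)) P)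
    (i : Fin M × Fin M) : ∫ ω, crossTerm i (z ω) ∂P = 0 := by
  simp only [crossTerm, h.integral_coordCLM_mul]
  rw [if_neg]
  rintro ⟨h1, h2⟩
  simp [h2] at h1

/-- Each Isserlis pairing must match a coordinate with a conjugated one. This requires two
conjugates among the four factors, hence `m < n` and `p < q`; the only candidate then needs `m = q`
and `n = p`, which contradicts the order. -/
lemma integral_crossTerm_mul (h : IsCircularGaussian z (Matrix.diagonal fun m => (v m : ℂ)) P)
    (i j : Fin M × Fin M) : ∫ ω, crossTerm i (z ω) * crossTerm j (z ω) ∂P = 0 := by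
  simp only [crossTerm]
  rw [integral_mul_four_of_hasGaussianLaw h.gaussian h.integral_eq_zero]
  simp only [h.integral_coordCLM_mul]
  obtain ⟨m, n⟩ := i
  obtain ⟨p, q⟩ := j
  grind

/-- The pairing `m = p`, `n = q` gives `v m * v n`. For unconjugated products the pairing `m = q`,
`n = p` also counts, but `n ≤ m` and `q ≤ p` force all indices equal: this is the factor `2` on the
diagonal in `crossPower`. -/
lemma integral_crossTerm_mul_conj
    (h : IsCircularGaussian z (Matrix.diagonal fun m => (v m : ℂ)) P) (i j : Fin M × Fin M) :
    ∫ ω, crossTerm i (z ω) * conj (crossTerm j (z ω)) ∂P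
      = if i = j then (crossPower v i : ℂ) else 0 := by
  simp only [crossTerm, map_mul, conj_coordCLM]
  rw [integral_mul_four_of_hasGaussianLaw h.gaussian h.integral_eq_zero]
  simp only [h.integral_coordCLM_mul, crossPower]
  obtain ⟨m, n⟩ := i
  obtain ⟨p, q⟩ := j
  simp only [Prod.mk.injEq]
  simp only [apply_ite Complex.ofReal]
  push_cast
  grind

end IsCircularGaussian

lemma crossPower_pos (hv : ∀ m, 0 < v m) (i : Fin M × Fin M) : 0 < crossPower v i := by
  have := mul_pos (hv i.1) (hv i.2)
  unfold crossPower
  split_ifs <;> linarith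

/-- The vector of all products `crossTerm i z`, each scaled to mean square `2`. -/
noncomputable def crossVector (v : Fin M → ℝ) (z : Fin M → ℂ) :
    PiLp 2 fun _ : Fin M × Fin M => ℂ :=
  WithLp.toLp 2 fun i => (√(2 / crossPower v i) : ℂ) * crossTerm i z

@[fun_prop]
lemma measurable_crossVector (v : Fin M → ℝ) : Measurable (crossVector v) :=
  (WithLp.measurable_toLp 2 _).comp
    (measurable_pi_lambda _ fun i => (measurable_crossTerm i).const_mul _)

lemma inner_crossVector (v : Fin M → ℝ) (z : Fin M → ℂ) (t : PiLp 2 fun _ : Fin M × Fin M => ℂ) :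
    inner ℝ (crossVector v z) t
      = (∑ i, (conj (t i) * (√(2 / crossPower v i) : ℂ)) * crossTerm i z).re := by
  rw [PiLp.inner_apply, Complex.re_sum]
  refine Finset.sum_congr rfl fun i _ => ?_
  rw [real_inner_comm, Complex.inner]
  simp only [crossVector]
  ring_nf

lemma finrank_crossVector (M : ℕ) :
    Module.finrank ℝ (PiLp 2 fun _ : Fin M × Fin M => ℂ) = 2 * M ^ 2 := by
  rw [(WithLp.linearEquiv 2 ℝ (Fin M × Fin M → ℂ)).finrank_eq, Module.finrank_pi_fintype]
  simp
  ring

namespace IsCircularGaussian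

variable {z : Ω → Fin M → ℂ}

lemma integral_inner_crossVector
    (h : IsCircularGaussian z (Matrix.diagonal fun m => (v m : ℂ)) P)
    (t : PiLp 2 fun _ : Fin M × Fin M => ℂ) :
    ∫ ω, inner ℝ (crossVector v (z ω)) t ∂P = 0 := by
  have hP := h.gaussian.isProbabilityMeasure
  have hi (i : Fin M × Fin M) : Integrable (fun ω =>
      (conj (t i) * (√(2 / crossPower v i) : ℂ)) * crossTerm i (z ω)) P :=
    ((h.memLp_crossTerm i).integrable (by norm_num)).const_mul _
  simp_rw [inner_crossVector]
  have := integral_re (integrable_finsetSum Finset.univ fun i _ => hi i)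
  simp only [RCLike.re_eq_complex_re] at this
  rw [this, integral_finsetSum _ fun i _ => hi i]
  simp [integral_const_mul, h.integral_crossTerm]

/-- The mean square `2` offsets the factor `1 / 2` lost by taking real parts. -/
lemma integral_inner_crossVector_sq (hv : ∀ m, 0 < v m)
    (h : IsCircularGaussian z (Matrix.diagonal fun m => (v m : ℂ)) P)
    (t : PiLp 2 fun _ : Fin M × Fin M => ℂ) :
    ∫ ω, inner ℝ (crossVector v (z ω)) t ^ 2 ∂P = ‖t‖ ^ 2 := by
  simp_rw [inner_crossVector]
  rw [integral_re_sum_sq (Z := fun i ω => crossTerm i (z ω)) h.memLp_crossTerm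
    h.integral_crossTerm_mul (crossPower v) h.integral_crossTerm_mul_conj, PiLp.norm_sq_eq_of_L2,
    Finset.sum_div]
  refine Finset.sum_congr rfl fun i _ => ?_
  have hc := crossPower_pos hv i
  rw [norm_mul, mul_pow, Complex.norm_real, Real.norm_eq_abs, sq_abs,
    Real.sq_sqrt (by positivity), RCLike.norm_conj]
  field_simp

lemma memLp_crossVector {R : Matrix (Fin M) (Fin M) ℂ} (h : IsCircularGaussian z R P) :
    MemLp (fun ω => crossVector v (z ω)) 2 P :=
  .of_eval_piLp fun i => (h.memLp_crossTerm i).const_mul _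

end IsCircularGaussian

/-! ### Limits along the i.i.d. sequence -/

section Sequence

variable {y : ℕ → Ω → Fin M → ℂ}

/-- The hypotheses fix only Gaussianity and the first two moments; these determine the law, as the
limit theorems require. -/
lemma identDistrib_of_isCircularGaussian
    (h : ∀ k, IsCircularGaussian (y k) (Matrix.diagonal fun m => (v m : ℂ)) P) (k : ℕ) :
    IdentDistrib (y k) (y 0) P P :=
  ⟨(h k).gaussian.aemeasurable, (h 0).gaussian.aemeasurable, (h k).map_eq (h 0)⟩

lemma tendstoInDistribution_crossVector [IsProbabilityMeasure P] (hv : ∀ m, 0 < v m)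
    (h_indep : iIndepFun y P)
    (h : ∀ k, IsCircularGaussian (y k) (Matrix.diagonal fun m => (v m : ℂ)) P) :
    TendstoInDistribution
      (fun (K : ℕ) ω => (√K)⁻¹ • ∑ k ∈ Finset.range K, crossVector v (y k ω)) atTop id
      (fun _ => P) (stdGaussian (PiLp 2 fun _ : Fin M × Fin M => ℂ)) :=
  tendstoInDistribution_stdGaussian (X := fun k ω => crossVector v (y k ω))
    (h 0).memLp_crossVector (h 0).integral_inner_crossVector
    ((h 0).integral_inner_crossVector_sq hv)
    (h_indep.comp (fun _ => crossVector v) fun _ => measurable_crossVector v)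
    fun k => (identDistrib_of_isCircularGaussian h k).comp (measurable_crossVector v)

lemma sampleCov_self_re (u : ℕ → Fin M → ℂ) (K : ℕ) (m : Fin M) :
    (sampleCov u K m m).re = (∑ k ∈ Finset.range K, ‖u k m‖ ^ 2) / K := by
  have : sampleCov u K m m = (((∑ k ∈ Finset.range K, ‖u k m‖ ^ 2) / K : ℝ) : ℂ) := by
    simp [sampleCov, Complex.mul_conj, Complex.normSq_eq_norm_sq]
    ring
  rw [this, Complex.ofReal_re]

lemma ae_tendsto_sampleCov_self [IsProbabilityMeasure P] (h_indep : iIndepFun y P)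
    (h : ∀ k, IsCircularGaussian (y k) (Matrix.diagonal fun m => (v m : ℂ)) P) (m : Fin M) :
    ∀ᵐ ω ∂P, Tendsto (fun K => (sampleCov (fun k => y k ω) K m m).re) atTop (𝓝 (v m)) := by
  have hm : Measurable fun z : Fin M → ℂ => ‖z m‖ ^ 2 := by fun_prop
  have hE : ∫ ω, ‖y 0 ω m‖ ^ 2 ∂P = v m := by
    have := (h 0).integral_mul_conj m m
    simp only [Complex.mul_conj, Complex.normSq_eq_norm_sq, if_true] at this
    rw [integral_complex_ofReal] at this
    exact_mod_cast this
  have := strong_law_ae_real (μ := P) (fun k ω => ‖y k ω m‖ ^ 2)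
    (((h 0).memLp_eval m (p := 2) (by simp)).norm.integrable_sq)
    (fun i j hij => (h_indep.indepFun hij).comp hm hm)
    (fun k => (identDistrib_of_isCircularGaussian h k).comp hm)
  simpa only [sampleCov_self_re, hE] using this

/-- The ratios of true to estimated powers. -/
noncomputable def powerRatio (v : Fin M → ℝ) (u : ℕ → Fin M → ℂ) (K : ℕ) (i : Fin M × Fin M) : ℝ :=
  v i.1 * v i.2 / ((sampleCov u K i.1 i.1).re * (sampleCov u K i.2 i.2).re)

lemma aemeasurable_powerRatio
    (h : ∀ k, IsCircularGaussian (y k) (Matrix.diagonal fun m => (v m : ℂ)) P) (K : ℕ) :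
    AEMeasurable (fun ω => powerRatio v (fun k => y k ω) K) P := by
  have hy (k : ℕ) (m : Fin M) : AEMeasurable (fun ω => y k ω m) P :=
    ((h k).memLp_eval m (p := 2) (by simp)).aemeasurable
  have hs (m : Fin M) : AEMeasurable (fun ω => (∑ k ∈ Finset.range K, ‖y k ω m‖ ^ 2) / K) P :=
    (Finset.aemeasurable_fun_sum _ fun k _ => (hy k m).norm.pow_const 2).div_const _
  refine aemeasurable_pi_lambda _ fun i => ?_
  simp only [powerRatio, sampleCov_self_re]
  exact ((hs i.1).mul (hs i.2)).const_div _

lemma tendstoInMeasure_powerRatio [IsProbabilityMeasure P] (hv : ∀ m, 0 < v m)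
    (h_indep : iIndepFun y P)
    (h : ∀ k, IsCircularGaussian (y k) (Matrix.diagonal fun m => (v m : ℂ)) P) :
    TendstoInMeasure P (fun K ω => powerRatio v (fun k => y k ω) K) atTop fun _ _ => 1 := by
  refine tendstoInMeasure_of_tendsto_ae
    (fun K => (aemeasurable_powerRatio h K).aestronglyMeasurable) ?_
  filter_upwards [ae_all_iff.2 (ae_tendsto_sampleCov_self h_indep h)] with ω hω
  refine tendsto_pi_nhds.2 fun i => ?_
  have hne : v i.1 * v i.2 ≠ 0 := (mul_pos (hv _) (hv _)).ne'
  have h := (tendsto_const_nhds (x := v i.1 * v i.2)).div ((hω i.1).mul (hω i.2)) hne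
  rwa [div_self hne] at h

end Sequence

/-! ### The statistic as a weighted squared norm, and the conclusion -/

lemma sum_prod_eq_sum_Ioi_add_sum_diag (f : Fin M × Fin M → ℝ) :
    ∑ i, f i = (∑ m, ∑ n ∈ Finset.Ioi m, f (m, n)) + ∑ m, f (m, m)
      + ∑ m, ∑ n ∈ Finset.Ioi m, f (n, m) := by
  have h := Finset.sum_sum_Ioi_add_eq_sum_sum_off_diag fun m n => f (m, n)
  simp only [Finset.sum_add_distrib] at h
  have h2 (m : Fin M) : ∑ n, f (n, m) = f (m, m) + ∑ n ∈ {m}ᶜ, f (n, m) :=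
    Fintype.sum_eq_add_sum_compl m fun n => f (n, m)
  rw [Fintype.sum_prod_type_right]
  simp only [h2, Finset.sum_add_distrib]
  linarith

/-- An exact identity, in which the true powers cancel between `powerRatio` and `crossPower`.
Division by zero being zero, it also covers `K = 0` and vanishing sample powers. -/
lemma two_mul_nccStatistic (hv : ∀ m, 0 < v m) (u : ℕ → Fin M → ℂ) (K : ℕ) :
    2 * (K : ℝ) * nccStatistic u K
      = ∑ i, powerRatio v u K i
        * ‖((√K)⁻¹ • ∑ k ∈ Finset.range K, crossVector v (u k)) i‖ ^ 2 := by
  have key (i : Fin M × Fin M) :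
      ‖((√K)⁻¹ • ∑ k ∈ Finset.range K, crossVector v (u k)) i‖ ^ 2
        = 2 / crossPower v i * K * ‖1 / (K : ℂ) * ∑ k ∈ Finset.range K, crossTerm i (u k)‖ ^ 2 := by
    have hc := crossPower_pos hv i
    have e : ((√K)⁻¹ • ∑ k ∈ Finset.range K, crossVector v (u k)) i
        = ((√K)⁻¹ : ℂ) * ((√(2 / crossPower v i) : ℂ) * ∑ k ∈ Finset.range K, crossTerm i (u k)) := by
      simp [crossVector, Finset.mul_sum]
    rw [e]
    simp only [norm_mul, mul_pow, norm_inv, norm_div, Complex.norm_real, Real.norm_eq_abs, inv_pow,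
      sq_abs, norm_one, Complex.norm_natCast, div_pow, one_pow]
    rw [Real.sq_sqrt (by positivity), Real.sq_sqrt (by positivity)]
    rcases Nat.eq_zero_or_pos K with rfl | hK
    · simp
    · field_simp
  simp_rw [key]
  rw [sum_prod_eq_sum_Ioi_add_sum_diag, nccStatistic, mul_add, mul_add]
  simp_rw [Finset.mul_sum]
  congr 1
  · congr 1
    · refine Finset.sum_congr rfl fun m _ => Finset.sum_congr rfl fun n hn => ?_
      have hmn : m < n := Finset.mem_Ioi.1 hn
      have h1 := (hv m).ne'
      have h2 := (hv n).ne'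
      simp only [crossTerm, coordCLM_apply, hmn, hmn.ne, decide_true, crossPower, powerRatio,
        sampleCov, Matrix.of_apply, if_true, if_false, Bool.false_eq_true]
      simp only [← Finset.mul_sum]
      field_simp
    · refine Finset.sum_congr rfl fun m _ => ?_
      have h1 := (hv m).ne'
      simp only [crossTerm, coordCLM_apply, lt_irrefl, decide_false, crossPower, powerRatio,
        sampleComplementaryCov, Matrix.of_apply, if_true, if_false, Bool.false_eq_true]
      simp only [← Finset.mul_sum]
      field_simp
  · refine Finset.sum_congr rfl fun m _ => Finset.sum_congr rfl fun n hn => ?_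
    have hmn : m < n := Finset.mem_Ioi.1 hn
    have h1 := (hv m).ne'
    have h2 := (hv n).ne'
    simp only [crossTerm, coordCLM_apply, hmn.not_gt, hmn.ne', decide_false, crossPower, powerRatio,
      sampleComplementaryCov, Matrix.of_apply, if_false, Bool.false_eq_true]
    simp_rw [mul_comm (u _ n) (u _ m)]
    simp only [← Finset.mul_sum]
    field_simp

end NCC

theorem mainTheorem1 {Ω : Type*} [MeasurableSpace Ω] (P : Measure Ω) [IsProbabilityMeasure P]
    (M : ℕ) (hM : 1 ≤ M) (v : Fin M → ℝ) (hv : ∀ m, 0 < v m)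
    (y : ℕ → Ω → Fin M → ℂ) (h_indep : iIndepFun y P)
    (h_law : ∀ k, NCC.IsCircularGaussian (y k) (Matrix.diagonal fun m => (v m : ℂ)) P) :
    TendstoInDistribution
        (fun (K : ℕ) (ω : Ω) => 2 * (K : ℝ) * NCC.nccStatistic (fun k => y k ω) K)
        atTop (id : ℝ → ℝ) (fun _ => P) (NCC.chiSquare (2 * M ^ 2)) ∧
      ∀ ε : ℝ, 0 < ε → ∀ᶠ K : ℕ in atTop, ∀ threshold : ℝ,
        |P.real {ω | threshold < NCC.nccStatistic (fun k => y k ω) K}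
            - NCC.chiSquareTail (2 * M ^ 2) (2 * (K : ℝ) * threshold)| < ε := by
  -- Slutsky: the weights converge in measure to the constant `1`, so a continuous function of
  -- vector and weights converges in law.
  have hd := (NCC.tendstoInDistribution_crossVector hv h_indep h_law
    ).continuous_comp_prodMk_of_tendstoInMeasure_const
      (g := fun p : (PiLp 2 fun _ : Fin M × Fin M => ℂ) × (Fin M × Fin M → ℝ) =>
        ∑ i, p.2 i * ‖p.1 i‖ ^ 2) (by fun_prop)
      (NCC.tendstoInMeasure_powerRatio hv h_indep h_law) (NCC.aemeasurable_powerRatio h_law)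
  simp_rw [← NCC.two_mul_nccStatistic hv] at hd
  have hlim : TendstoInDistribution
      (fun (K : ℕ) (ω : Ω) => 2 * (K : ℝ) * NCC.nccStatistic (fun k => y k ω) K)
      atTop (id : ℝ → ℝ) (fun _ => P) (NCC.chiSquare (2 * M ^ 2)) := by
    refine ⟨hd.forall_aemeasurable, aemeasurable_id, ?_⟩
    convert! hd.tendsto using 3
    refine congrArg _ (Subtype.ext ?_)
    change Measure.map id _ = Measure.map _ _
    rw [Measure.map_id, ← NCC.finrank_crossVector, ← NCC.map_norm_sq_stdGaussian]
    simp [PiLp.norm_sq_eq_of_L2]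
  refine ⟨hlim, fun ε hε => ?_⟩
  have hu := NCC.eventually_forall_abs_tail_sub_lt hlim.tendsto
    (by simpa using NCC.chiSquare_singleton (2 * M ^ 2) (by positivity)) hε
  -- The bound is uniform in the point, so it may be used at `2 * K * threshold`, which moves with
  -- `K`; `K > 0` makes this rescaling strictly monotone.
  filter_upwards [hu, eventually_gt_atTop 0] with K hK hK0 threshold
  have h := hK (2 * K * threshold)
  rw [ProbabilityMeasure.coe_mk, ProbabilityMeasure.coe_mk,
    map_measureReal_apply_of_aemeasurable (hlim.forall_aemeasurable K) measurableSet_Ioi,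
    Measure.map_id] at h
  have hK' : (0 : ℝ) < 2 * K := by positivity
  convert! h using 5
  ext ω
  simp [mul_lt_mul_iff_right₀ hK']
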